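/- Let $H$ be a complex Hilbert space, $T$ a bounded linear operator on $H$, and let $n,k\ge 1$ be integers. For a contraction $T$ write $D_T=(I-T^*T)^{1/2}$, $\mathcal D_T=\overline{D_TH}$ and $\mathcal D_{T^*}=\overline{D_{T^*}H}$ with $D_{T^*}=(I-TT^*)^{1/2}$. A contraction is completely non-unitary (c.n.u.) if no nonzero closed subspace $M$ of $H$ reduces $T$ with $T|_M$ unitary on $M$. For an orthonormal basis $\{e_m\}_{m\ge1}$ of $H$, let $P_j$ be the orthogonal projection onto $\operatorname{span}\{e_1,\dots,e_j\}$ and let $S_k$ be the unilateral shift of multiplicity $k$, i.e. the bounded operator with $S_ke_m=e_{m+k}$ for all $m\ge1$. For a bounded operator $F$ on $H$ put $F_1=F+S_kP_n$ and, for $r\ge2$, $$F_r=F_1^r+S_k(I-P_n)F_1^{r-1}+\cdots+S_k^{r-1}(I-P_n)F_1 .$$ Theorem. The following are equivalent. (a) $T$ is a c.n.u. contraction, $\mathcal D_T\subseteq\mathcal D_{T^*}$, $\dim\mathcal D_T=n$, $\dim\mathcal D_{T^*}<\infty$ and $\dim(\mathcal D_{T^*}\ominus\mathcal D_T)=k$.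 (b) There are an orthonormal basis $\{e_m\}_{m\ge1}$ of $H$ and a bounded finite-rank operator $F$ on $H$ such that $T=S_k+F$ and 1. $\operatorname{rank}(P_n-F_1^*F_1)=n$; 2. $F_1(I-P_n)=(I-P_{n+k})F_1=0$; 3. for some $\lambda\ge0$, $\ \lambda\|F_1^*x\|^2-\|F_1x\|^2\le\lambda\|P_{n+k}x\|^2-\|P_nx\|^2$ for all $x\in H$; 4. $\|F_rx\|\le\|P_nx\|$ and $\|F_r^*x\|\le\|P_{n+kr}x\|$ for all integers $r\ge1$ and all $x\in H$, and $x=0$ is the only vector such that $\|F_rx\|=\|P_nx\|$ and $\|F_r^*x\|=\|P_{n+kr}x\|$ for all $r\ge1$. -/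

import Mathlib

/-- The defect operator `D_T = (I - T* T)^{1/2}` (the positive square root; it is used for
contractions `T`, where `I - T* T` is positive). Thus `D_{T*}` is `defectOp` of the adjoint. -/
noncomputable def defectOp {H : Type*} [NormedAddCommGroup H] [InnerProductSpace ℂ H]
    [CompleteSpace H] (T : H →L[ℂ] H) : H →L[ℂ] H :=
  CFC.sqrt (1 - ContinuousLinearMap.adjoint T * T)

/-- The defect space of `T`: the closure of the range of the defect operator. -/
noncomputable def defectSpace {H : Type*} [NormedAddCommGroup H] [InnerProductSpace ℂ H]
    [CompleteSpace H] (T : H →L[ℂ] H) : Submodule ℂ H :=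
  (LinearMap.range (defectOp T).toLinearMap).topologicalClosure

/-- `M` reduces `T`: both `M` and its orthogonal complement are invariant under `T`. -/
def Reduces {H : Type*} [NormedAddCommGroup H] [InnerProductSpace ℂ H]
    (M : Submodule ℂ H) (T : H →L[ℂ] H) : Prop :=
  (∀ x ∈ M, T x ∈ M) ∧ (∀ x ∈ Mᗮ, T x ∈ Mᗮ)

/-- The restriction of `T` to `M` is a unitary operator of `M` onto `M`. -/
def UnitaryOn {H : Type*} [NormedAddCommGroup H] [InnerProductSpace ℂ H]
    (M : Submodule ℂ H) (T : H →L[ℂ] H) : Prop :=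
  ∃ U : M ≃ₗᵢ[ℂ] M, ∀ x : M, T (x : H) = (U x : H)

/-- `T` is a completely non-unitary contraction: `‖T‖ ≤ 1`, and no nonzero closed subspace
reduces `T` to a unitary operator. -/
def IsCNUContraction {H : Type*} [NormedAddCommGroup H] [InnerProductSpace ℂ H]
    (T : H →L[ℂ] H) : Prop :=
  ‖T‖ ≤ 1 ∧
    ∀ M : Submodule ℂ H, IsClosed (M : Set H) → Reduces M T → UnitaryOn M T → M = ⊥

/-- The span of the first `n` vectors `e 0, …, e (n-1)` of an orthonormal basis, which is indexed
from `0` here. -/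
def firstSpan {H : Type*} [NormedAddCommGroup H] [InnerProductSpace ℂ H]
    (e : HilbertBasis ℕ ℂ H) (n : ℕ) : Submodule ℂ H :=
  Submodule.span ℂ (Set.range fun i : Fin n => e i)

instance firstSpan_finiteDimensional {H : Type*} [NormedAddCommGroup H] [InnerProductSpace ℂ H]
    (e : HilbertBasis ℕ ℂ H) (n : ℕ) : FiniteDimensional ℂ (firstSpan e n) :=
  FiniteDimensional.span_of_finite ℂ (Set.finite_range _)

/-- The orthogonal projection onto the span of the first `n` vectors of an orthonormal basis. -/
noncomputable def firstProj {H : Type*} [NormedAddCommGroup H] [InnerProductSpace ℂ H]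
    (e : HilbertBasis ℕ ℂ H) (n : ℕ) : H →L[ℂ] H :=
  (firstSpan e n).starProjection

theorem orthonormal_shifted {H : Type*} [NormedAddCommGroup H] [InnerProductSpace ℂ H]
    (e : HilbertBasis ℕ ℂ H) (k : ℕ) : Orthonormal ℂ (fun m : ℕ => e (m + k)) :=
  e.orthonormal.comp (fun m : ℕ => m + k) (add_left_injective k)

/-- The unilateral shift of multiplicity `k` along the orthonormal basis `e`: the bounded operator
with `e m ↦ e (m + k)`. -/
noncomputable def shiftOp {H : Type*} [NormedAddCommGroup H] [InnerProductSpace ℂ H]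
    [CompleteSpace H] (e : HilbertBasis ℕ ℂ H) (k : ℕ) : H →L[ℂ] H :=
  ((orthonormal_shifted e k).orthogonalFamily.linearIsometry.comp
    e.repr.toLinearIsometry).toContinuousLinearMap

theorem shiftOp_apply_basis {H : Type*} [NormedAddCommGroup H] [InnerProductSpace ℂ H]
    [CompleteSpace H] (e : HilbertBasis ℕ ℂ H) (k m : ℕ) :
    shiftOp e k (e m) = e (m + k) := by
  change (orthonormal_shifted e k).orthogonalFamily.linearIsometry (e.repr (e m)) = e (m + k)
  rw [HilbertBasis.repr_self, OrthogonalFamily.linearIsometry_apply_single]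
  simp

/-- The operators `F_r`, `r ≥ 1`, attached to a basis `e`, to `n`, `k` and to `F`:
`F_1 = F + S_k P_n`, and for `r ≥ 2`
`F_r = F_1^r + S_k (I - P_n) F_1^(r-1) + ⋯ + S_k^(r-1) (I - P_n) F_1`.
(The sum is empty for `r = 1`.) -/
noncomputable def Fop {H : Type*} [NormedAddCommGroup H] [InnerProductSpace ℂ H]
    [CompleteSpace H] (e : HilbertBasis ℕ ℂ H) (n k : ℕ) (F : H →L[ℂ] H) (r : ℕ) : H →L[ℂ] H :=
  (F + shiftOp e k * firstProj e n) ^ r +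
    ∑ j ∈ Finset.Ico 1 r,
      shiftOp e k ^ j * (1 - firstProj e n) * (F + shiftOp e k * firstProj e n) ^ (r - j)

theorem Fop_one {H : Type*} [NormedAddCommGroup H] [InnerProductSpace ℂ H]
    [CompleteSpace H] (e : HilbertBasis ℕ ℂ H) (n k : ℕ) (F : H →L[ℂ] H) :
    Fop e n k F 1 = F + shiftOp e k * firstProj e n := by
  simp [Fop]

/-- The four conditions on a bounded operator `F`, relative to `e`, `n` and `k`. -/
structure PerturbationConditions {H : Type*} [NormedAddCommGroup H] [InnerProductSpace ℂ H]
    [CompleteSpace H] (e : HilbertBasis ℕ ℂ H) (n k : ℕ) (F : H →L[ℂ] H) : Prop where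
  /-- `rank (P_n - F_1* F_1) = n` -/
  rank_eq : LinearMap.rank (firstProj e n -
    ContinuousLinearMap.adjoint (Fop e n k F 1) * Fop e n k F 1).toLinearMap = n
  /-- `F_1 (I - P_n) = 0` -/
  supp_right : Fop e n k F 1 * (1 - firstProj e n) = 0
  /-- `(I - P_{n+k}) F_1 = 0` -/
  supp_left : (1 - firstProj e (n + k)) * Fop e n k F 1 = 0
  /-- the Douglas-type inequality -/
  douglas : ∃ c : ℝ, 0 ≤ c ∧ ∀ x : H,
    c * ‖ContinuousLinearMap.adjoint (Fop e n k F 1) x‖ ^ 2 - ‖Fop e n k F 1 x‖ ^ 2 ≤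
      c * ‖firstProj e (n + k) x‖ ^ 2 - ‖firstProj e n x‖ ^ 2
  /-- `‖F_r x‖ ≤ ‖P_n x‖` -/
  norm_le : ∀ r : ℕ, 1 ≤ r → ∀ x : H, ‖Fop e n k F r x‖ ≤ ‖firstProj e n x‖
  /-- `‖F_r* x‖ ≤ ‖P_{n+kr} x‖` -/
  norm_adjoint_le : ∀ r : ℕ, 1 ≤ r → ∀ x : H,
    ‖ContinuousLinearMap.adjoint (Fop e n k F r) x‖ ≤ ‖firstProj e (n + k * r) x‖
  /-- zero is the only common solution of all the corresponding equalities -/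
  eq_zero_of_norm_eq : ∀ x : H,
    (∀ r : ℕ, 1 ≤ r → ‖Fop e n k F r x‖ = ‖firstProj e n x‖ ∧
      ‖ContinuousLinearMap.adjoint (Fop e n k F r) x‖ = ‖firstProj e (n + k * r) x‖) → x = 0

/-! ### Defect spaces and the unitary part of a contraction. -/

section Contractions

open ContinuousLinearMap

variable {H : Type*} [NormedAddCommGroup H] [InnerProductSpace ℂ H] [CompleteSpace H]

/-! Write `D`, `D'` for the defect spaces of `T` and `T*`. A contraction `T` is isometric exactly on
`Dᗮ` and maps it onto `D'ᗮ`. If `D ≤ D'`, then `D'ᗮ ≤ Dᗮ`, so `T` restricts to an isometry of `Dᗮ`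
with wandering subspace `D' ⊖ D`, of dimension `k`. As in the Wold decomposition, a basis of `D`, a
basis of `D' ⊖ D` and the images of the latter under powers of `T` form an orthonormal family. What
it misses reduces `T` to a unitary, hence is zero when `T` is c.n.u. In this basis `T` is the shift
by `k` from index `n` on and maps the first `n` vectors into the span of the first `n + k`
(`exists_shiftsTail_basis`).

Conversely, conditions 1-4 are contraction statements read in such a basis. For `F = T - S_k` the
sum `F_r` telescopes to `T^r P_n` (`Fop_sub_shiftOp`). Off `P_n` the powers of `T` are shifts, so
`‖T^r x‖² - ‖x‖² = ‖F_r x‖² - ‖P_n x‖²`, and similarly for adjoints with `P_{n+kr}`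
(`norm_sq_pow_apply`, `norm_sq_adjoint_pow_apply`). Condition 4 thus says that `T` is a c.n.u.
contraction, condition 1 that `D` is the span of the first `n` vectors, and condition 3 that `D_T² ≤
λ D_{T*}²`. -/

omit [CompleteSpace H] in
theorem norm_apply_le_of_norm_le_one {T : H →L[ℂ] H} (hT : ‖T‖ ≤ 1) (x : H) : ‖T x‖ ≤ ‖x‖ := by
  simpa using T.le_of_opNorm_le hT x

theorem norm_adjoint_le_one {T : H →L[ℂ] H} (hT : ‖T‖ ≤ 1) : ‖adjoint T‖ ≤ 1 := by
  simpa using hT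

theorem norm_pow_le_one {T : H →L[ℂ] H} (hT : ‖T‖ ≤ 1) (r : ℕ) : ‖T ^ r‖ ≤ 1 := by
  induction r with
  | zero => exact norm_id_le
  | succ r ih =>
    rw [pow_succ]
    exact (norm_mul_le _ _).trans (mul_le_one₀ ih (norm_nonneg _) hT)

theorem adjoint_pow (T : H →L[ℂ] H) (r : ℕ) : adjoint (T ^ r) = adjoint T ^ r := by
  simp only [← star_eq_adjoint, star_pow]

theorem adjoint_mul (A B : H →L[ℂ] H) : adjoint (A * B) = adjoint B * adjoint A := by
  simp only [← star_eq_adjoint, star_mul]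

/-- Expand `‖T*Tx - x‖²`: the cross term is `-2‖Tx‖²`, so if `‖Tx‖ = ‖x‖` the total is at most zero.
Norm equalities thereby become linear conditions. -/
theorem adjoint_apply_apply_eq_iff {T : H →L[ℂ] H} (hT : ‖T‖ ≤ 1) (x : H) :
    adjoint T (T x) = x ↔ ‖T x‖ = ‖x‖ := by
  have key : (inner ℂ (adjoint T (T x)) x).re = ‖T x‖ ^ 2 := by
    rw [adjoint_inner_left]
    exact inner_self_eq_norm_sq (𝕜 := ℂ) (T x)
  constructor
  · intro h
    rw [h] at key
    have h2 : (inner ℂ x x).re = ‖x‖ ^ 2 := inner_self_eq_norm_sq (𝕜 := ℂ) x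
    rw [← sq_eq_sq₀ (norm_nonneg _) (norm_nonneg _), ← key, h2]
  · intro h
    have h1 := @norm_sub_sq ℂ _ _ _ _ (adjoint T (T x)) x
    have h2 : ‖adjoint T (T x)‖ ≤ ‖x‖ :=
      (norm_apply_le_of_norm_le_one (norm_adjoint_le_one hT) _).trans h.le
    rw [show RCLike.re (inner ℂ (adjoint T (T x)) x) = ‖T x‖ ^ 2 from key, h] at h1
    have h3 := pow_le_pow_left₀ (norm_nonneg _) h2 2
    have h4 : ‖adjoint T (T x) - x‖ = 0 := by
      rw [← sq_eq_zero_iff]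
      exact le_antisymm (by linarith) (sq_nonneg _)
    exact sub_eq_zero.1 (norm_eq_zero.1 h4)

theorem one_sub_adjoint_mul_self_nonneg {T : H →L[ℂ] H} (hT : ‖T‖ ≤ 1) :
    0 ≤ 1 - adjoint T * T := by
  rw [nonneg_iff_isPositive, isPositive_def']
  refine ⟨by simp [IsSelfAdjoint, star_sub, star_mul, star_eq_adjoint], fun x => ?_⟩
  have h := pow_le_pow_left₀ (norm_nonneg _) (norm_apply_le_of_norm_le_one hT x) 2
  have h1 : RCLike.re (inner ℂ x x) = ‖x‖ ^ 2 := inner_self_eq_norm_sq (𝕜 := ℂ) x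
  have h2 : RCLike.re (inner ℂ (T x) (T x)) = ‖T x‖ ^ 2 := inner_self_eq_norm_sq (𝕜 := ℂ) (T x)
  simp only [reApplyInnerSelf, sub_apply, one_apply_eq_self, mul_apply_eq_comp, inner_sub_left,
    adjoint_inner_left, map_sub, h1, h2]
  linarith

theorem isSelfAdjoint_defectOp (T : H →L[ℂ] H) : adjoint (defectOp T) = defectOp T :=
  (IsSelfAdjoint.of_nonneg (CFC.sqrt_nonneg (1 - adjoint T * T))).star_eq

theorem norm_sq_defectOp_apply {T : H →L[ℂ] H} (hT : ‖T‖ ≤ 1) (x : H) :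
    ‖defectOp T x‖ ^ 2 = ‖x‖ ^ 2 - ‖T x‖ ^ 2 := by
  have h1 : RCLike.re (inner ℂ x x) = ‖x‖ ^ 2 := inner_self_eq_norm_sq (𝕜 := ℂ) x
  have h2 : RCLike.re (inner ℂ (T x) (T x)) = ‖T x‖ ^ 2 := inner_self_eq_norm_sq (𝕜 := ℂ) (T x)
  rw [apply_norm_sq_eq_inner_adjoint_left, isSelfAdjoint_defectOp, ← mul_def, defectOp,
    CFC.sqrt_mul_sqrt_self _ (one_sub_adjoint_mul_self_nonneg hT)]
  simp only [sub_apply, one_apply_eq_self, mul_apply_eq_comp, inner_sub_left,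
    adjoint_inner_left, map_sub, h1, h2]

theorem mem_orthogonal_defectSpace_iff_norm_eq {T : H →L[ℂ] H} (hT : ‖T‖ ≤ 1) (x : H) :
    x ∈ (defectSpace T)ᗮ ↔ ‖T x‖ = ‖x‖ := by
  rw [defectSpace, Submodule.orthogonal_closure, orthogonal_range, isSelfAdjoint_defectOp,
    LinearMap.mem_ker, coe_coe, ← norm_eq_zero, ← sq_eq_zero_iff, norm_sq_defectOp_apply hT,
    sub_eq_zero, sq_eq_sq₀ (norm_nonneg _) (norm_nonneg _), eq_comm]

theorem mem_orthogonal_defectSpace_iff {T : H →L[ℂ] H} (hT : ‖T‖ ≤ 1) (x : H) :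
    x ∈ (defectSpace T)ᗮ ↔ adjoint T (T x) = x := by
  rw [mem_orthogonal_defectSpace_iff_norm_eq hT, adjoint_apply_apply_eq_iff hT]

theorem orthogonal_orthogonal_defectSpace (T : H →L[ℂ] H) :
    (defectSpace T)ᗮᗮ = defectSpace T := by
  rw [Submodule.orthogonal_orthogonal_eq_closure]
  exact IsClosed.submodule_topologicalClosure_eq (Submodule.isClosed_topologicalClosure _)

/-- Both sides are closures of ranges of self-adjoint operators with the same kernel. This removes
the square root. -/
theorem defectSpace_eq_closure_range {T : H →L[ℂ] H} (hT : ‖T‖ ≤ 1) :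
    defectSpace T = (LinearMap.range (1 - adjoint T * T).toLinearMap).topologicalClosure := by
  rw [← Submodule.orthogonal_orthogonal_eq_closure, ← orthogonal_orthogonal_defectSpace]
  congr 1
  ext x
  have : adjoint (1 - adjoint T * T) = 1 - adjoint T * T := by
    simp [← star_eq_adjoint, star_sub, star_mul]
  rw [mem_orthogonal_defectSpace_iff hT, orthogonal_range, this, LinearMap.mem_ker, coe_coe,
    sub_apply, sub_eq_zero, eq_comm]
  rfl

/-- If `T*Tx = x`, then `TT*(Tx) = Tx`. -/
theorem map_orthogonal_defectSpace {T : H →L[ℂ] H} (hT : ‖T‖ ≤ 1) {x : H}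
    (hx : x ∈ (defectSpace T)ᗮ) : T x ∈ (defectSpace (adjoint T))ᗮ := by
  rw [mem_orthogonal_defectSpace_iff hT] at hx
  rw [mem_orthogonal_defectSpace_iff (norm_adjoint_le_one hT), adjoint_adjoint, hx]

theorem adjoint_map_orthogonal_defectSpace {T : H →L[ℂ] H} (hT : ‖T‖ ≤ 1) {x : H}
    (hx : x ∈ (defectSpace (adjoint T))ᗮ) : adjoint T x ∈ (defectSpace T)ᗮ := by
  simpa using map_orthogonal_defectSpace (norm_adjoint_le_one hT) hx

theorem map_defectSpace {T : H →L[ℂ] H} (hT : ‖T‖ ≤ 1) {x : H}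
    (hx : x ∈ defectSpace T) : T x ∈ defectSpace (adjoint T) := by
  rw [← orthogonal_orthogonal_defectSpace, Submodule.mem_orthogonal']
  intro y hy
  rw [← adjoint_inner_right]
  exact (Submodule.mem_orthogonal _ _).1 (adjoint_map_orthogonal_defectSpace hT hy) x hx

theorem inner_map_map_of_mem_orthogonal_defectSpace {T : H →L[ℂ] H} (hT : ‖T‖ ≤ 1) (x : H) {y : H}
    (hy : y ∈ (defectSpace T)ᗮ) : inner ℂ (T x) (T y) = inner ℂ x y := by
  rw [← adjoint_inner_right, (mem_orthogonal_defectSpace_iff hT y).1 hy]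

/-- The vectors on which all powers of `T` and of its adjoint are isometric. -/
noncomputable def unitaryPart (T : H →L[ℂ] H) : Submodule ℂ H :=
  ⨅ r : ℕ, LinearMap.ker (1 - adjoint (T ^ r) * T ^ r).toLinearMap ⊓
    LinearMap.ker (1 - T ^ r * adjoint (T ^ r)).toLinearMap

theorem isClosed_unitaryPart (T : H →L[ℂ] H) : IsClosed (unitaryPart T : Set H) := by
  simp only [unitaryPart, Submodule.coe_iInf, Submodule.coe_inf]
  exact isClosed_iInter fun r => (isClosed_ker _).inter (isClosed_ker _)

theorem mem_unitaryPart_iff {T : H →L[ℂ] H} (hT : ‖T‖ ≤ 1) (x : H) :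
    x ∈ unitaryPart T ↔ ∀ r : ℕ, ‖(T ^ r) x‖ = ‖x‖ ∧ ‖(adjoint T ^ r) x‖ = ‖x‖ := by
  simp only [unitaryPart, Submodule.mem_iInf, Submodule.mem_inf, LinearMap.mem_ker, coe_coe,
    sub_apply, one_apply_eq_self, mul_apply_eq_comp, sub_eq_zero]
  refine forall_congr' fun r => and_congr ?_ ?_
  · rw [eq_comm, adjoint_apply_apply_eq_iff (norm_pow_le_one hT r)]
  · have h := adjoint_apply_apply_eq_iff (norm_adjoint_le_one (norm_pow_le_one hT r)) x
    rw [adjoint_adjoint] at h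
    rw [eq_comm, h, adjoint_pow]

theorem map_mem_unitaryPart {T : H →L[ℂ] H} (hT : ‖T‖ ≤ 1) {x : H} (hx : x ∈ unitaryPart T) :
    T x ∈ unitaryPart T := by
  rw [mem_unitaryPart_iff hT] at hx ⊢
  have h1 : ‖T x‖ = ‖x‖ := by simpa using (hx 1).1
  refine fun r => ⟨?_, ?_⟩
  · rw [h1, ← (hx (r + 1)).1, pow_succ]
    rfl
  · cases r with
    | zero => simp
    | succ r =>
      rw [pow_succ, mul_apply_eq_comp, (adjoint_apply_apply_eq_iff hT x).2 h1, (hx r).2, h1]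

theorem unitaryPart_adjoint {T : H →L[ℂ] H} (hT : ‖T‖ ≤ 1) :
    unitaryPart (adjoint T) = unitaryPart T := by
  ext x
  rw [mem_unitaryPart_iff hT, mem_unitaryPart_iff (norm_adjoint_le_one hT), adjoint_adjoint]
  exact forall_congr' fun r => and_comm

theorem adjoint_map_mem_unitaryPart {T : H →L[ℂ] H} (hT : ‖T‖ ≤ 1) {x : H}
    (hx : x ∈ unitaryPart T) : adjoint T x ∈ unitaryPart T := by
  rw [← unitaryPart_adjoint hT] at hx ⊢
  exact map_mem_unitaryPart (norm_adjoint_le_one hT) hx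

theorem reduces_unitaryPart {T : H →L[ℂ] H} (hT : ‖T‖ ≤ 1) : Reduces (unitaryPart T) T := by
  refine ⟨fun x hx => map_mem_unitaryPart hT hx, fun x hx => ?_⟩
  rw [Submodule.mem_orthogonal] at hx ⊢
  intro y hy
  rw [← adjoint_inner_left]
  exact hx _ (adjoint_map_mem_unitaryPart hT hy)

theorem unitaryOn_unitaryPart {T : H →L[ℂ] H} (hT : ‖T‖ ≤ 1) : UnitaryOn (unitaryPart T) T := by
  let f : unitaryPart T →ₗᵢ[ℂ] unitaryPart T :=
    { toLinearMap := T.toLinearMap.restrict fun x hx => map_mem_unitaryPart hT hx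
      norm_map' := fun x => by
        simpa using ((mem_unitaryPart_iff hT _).1 x.2 1).1 }
  refine ⟨LinearIsometryEquiv.ofSurjective f fun x => ?_, fun x => rfl⟩
  refine ⟨⟨adjoint T x, adjoint_map_mem_unitaryPart hT x.2⟩, Subtype.ext ?_⟩
  have h1 := (adjoint_apply_apply_eq_iff (norm_adjoint_le_one hT) (x : H)).2
    (by simpa using ((mem_unitaryPart_iff hT _).1 x.2 1).2)
  rwa [adjoint_adjoint] at h1

/-- Maximality of the unitary part; it also yields the completeness of the wandering basis. -/
theorem le_unitaryPart {T : H →L[ℂ] H} (hT : ‖T‖ ≤ 1) {M : Submodule ℂ H}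
    (h1 : ∀ x ∈ M, T x ∈ M ∧ ‖T x‖ = ‖x‖)
    (h2 : ∀ x ∈ M, adjoint T x ∈ M ∧ ‖adjoint T x‖ = ‖x‖) : M ≤ unitaryPart T := by
  intro x hx
  rw [mem_unitaryPart_iff hT]
  have aux : ∀ (A : H →L[ℂ] H), (∀ x ∈ M, A x ∈ M ∧ ‖A x‖ = ‖x‖) →
      ∀ r : ℕ, ∀ x ∈ M, ‖(A ^ r) x‖ = ‖x‖ := by
    intro A hA r
    induction r with
    | zero => simp
    | succ r ih =>
      intro x hx
      rw [pow_succ, mul_apply_eq_comp, ih _ (hA x hx).1, (hA x hx).2]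
  exact fun r => ⟨aux T h1 r x hx, aux _ h2 r x hx⟩

theorem isCNUContraction_iff {T : H →L[ℂ] H} :
    IsCNUContraction T ↔ ‖T‖ ≤ 1 ∧ unitaryPart T = ⊥ := by
  refine and_congr_right fun hT => ⟨fun h => ?_, fun h M _ _ hU => ?_⟩
  · exact h _ (isClosed_unitaryPart T) (reduces_unitaryPart hT) (unitaryOn_unitaryPart hT)
  · obtain ⟨U, hU⟩ := hU
    rw [eq_bot_iff, ← h]
    have h1 : ∀ x ∈ M, T x ∈ M ∧ ‖T x‖ = ‖x‖ := fun x hx => by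
      have := hU ⟨x, hx⟩
      simp only at this
      rw [this]
      exact ⟨Subtype.prop _, U.norm_map ⟨x, hx⟩⟩
    refine le_unitaryPart hT h1 fun x hx => ?_
    -- On `M` the adjoint acts as the inverse of `U`, hence also preserves `M` and norms.
    have hy := (U.symm ⟨x, hx⟩).2
    have hT' : T (U.symm ⟨x, hx⟩ : M) = x := by simp [hU]
    have h3 := (adjoint_apply_apply_eq_iff hT _).2 (h1 _ hy).2
    rw [hT'] at h3
    rw [h3]
    exact ⟨hy, U.symm.norm_map ⟨x, hx⟩⟩

/-- `D_{T*}` is injective on its finite-dimensional defect space, hence bounded below there; on the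
orthogonal complement both defect operators vanish, by the inclusion. The constant is the square of
an inverse bound. -/
theorem exists_norm_sq_defect_le {T : H →L[ℂ] H} (hT : ‖T‖ ≤ 1)
    (hle : defectSpace T ≤ defectSpace (adjoint T))
    [FiniteDimensional ℂ (defectSpace (adjoint T))] :
    ∃ c : ℝ, 0 ≤ c ∧ ∀ x : H,
      ‖x‖ ^ 2 - ‖T x‖ ^ 2 ≤ c * (‖x‖ ^ 2 - ‖adjoint T x‖ ^ 2) := by
  have hT' := norm_adjoint_le_one hT
  set E := defectSpace (adjoint T) with hE
  let f : E →ₗ[ℂ] H := (defectOp (adjoint T)).toLinearMap.domRestrict E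
  have hf : LinearMap.ker f = ⊥ := by
    rw [LinearMap.ker_eq_bot']
    intro x hx
    have h0 : ‖defectOp (adjoint T) x‖ ^ 2 = 0 := by
      rw [show defectOp (adjoint T) x = 0 from hx]
      simp
    rw [norm_sq_defectOp_apply hT', sub_eq_zero, sq_eq_sq₀ (norm_nonneg _) (norm_nonneg _)] at h0
    have h1 := (mem_orthogonal_defectSpace_iff_norm_eq hT' (x : H)).2 h0.symm
    have h2 : (x : H) ∈ E ⊓ Eᗮ := ⟨x.2, h1⟩
    rw [Submodule.inf_orthogonal_eq_bot] at h2
    exact Subtype.ext h2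
  obtain ⟨K, _, hK⟩ := f.exists_antilipschitzWith hf
  refine ⟨(K : ℝ) ^ 2, by positivity, fun x => ?_⟩
  obtain ⟨y, hy, z, hz, rfl⟩ := E.exists_add_mem_mem_orthogonal x
  have hzT : z ∈ (defectSpace T)ᗮ := Submodule.orthogonal_le hle hz
  have hD : defectOp T z = 0 := by
    rw [mem_orthogonal_defectSpace_iff_norm_eq hT] at hzT
    rw [← norm_eq_zero, ← sq_eq_zero_iff, norm_sq_defectOp_apply hT, hzT, sub_self]
  have hD' : defectOp (adjoint T) z = 0 := by
    have := (mem_orthogonal_defectSpace_iff_norm_eq hT' z).1 hz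
    rw [← norm_eq_zero, ← sq_eq_zero_iff, norm_sq_defectOp_apply hT', this, sub_self]
  rw [← norm_sq_defectOp_apply hT, ← norm_sq_defectOp_apply hT', map_add, map_add, hD, hD',
    add_zero, add_zero, norm_sq_defectOp_apply hT]
  have h1 : ‖y‖ ≤ K * ‖defectOp (adjoint T) y‖ := by
    simpa [f] using hK.le_mul_dist ⟨y, hy⟩ 0
  calc ‖y‖ ^ 2 - ‖T y‖ ^ 2 ≤ ‖y‖ ^ 2 := sub_le_self _ (sq_nonneg _)
    _ ≤ (K * ‖defectOp (adjoint T) y‖) ^ 2 := pow_le_pow_left₀ (norm_nonneg _) h1 2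
    _ = _ := mul_pow _ _ _

end Contractions

/-! ### Operators that agree with the shift on a tail of the basis. -/

section ShiftedTail

open ContinuousLinearMap

variable {H : Type*} [NormedAddCommGroup H] [InnerProductSpace ℂ H]

theorem ext_hilbertBasis (e : HilbertBasis ℕ ℂ H) {A B : H →L[ℂ] H}
    (h : ∀ m, A (e m) = B (e m)) : A = B := by
  refine ContinuousLinearMap.ext_on (s := Set.range e) ?_ ?_
  · rw [Submodule.dense_iff_topologicalClosure_eq_top, e.dense_span]
  · rintro _ ⟨m, rfl⟩
    exact h m

theorem inner_hilbertBasis (e : HilbertBasis ℕ ℂ H) (i j : ℕ) :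
    inner ℂ (e i) (e j) = if i = j then (1 : ℂ) else 0 :=
  orthonormal_iff_ite.1 e.orthonormal i j

theorem basis_mem_firstSpan (e : HilbertBasis ℕ ℂ H) {n m : ℕ} (h : m < n) :
    e m ∈ firstSpan e n :=
  Submodule.subset_span ⟨⟨m, h⟩, rfl⟩

theorem firstSpan_le_iff (e : HilbertBasis ℕ ℂ H) (n : ℕ) (M : Submodule ℂ H) :
    firstSpan e n ≤ M ↔ ∀ m < n, e m ∈ M := by
  rw [firstSpan, Submodule.span_le]
  constructor
  · exact fun h m hm => h ⟨⟨m, hm⟩, rfl⟩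
  · rintro h _ ⟨m, rfl⟩
    exact h m m.2

theorem firstSpan_mono (e : HilbertBasis ℕ ℂ H) {n m : ℕ} (h : n ≤ m) :
    firstSpan e n ≤ firstSpan e m :=
  (firstSpan_le_iff e n _).2 fun _ hi => basis_mem_firstSpan e (hi.trans_le h)

theorem mem_orthogonal_firstSpan_iff (e : HilbertBasis ℕ ℂ H) (n : ℕ) (x : H) :
    x ∈ (firstSpan e n)ᗮ ↔ ∀ m < n, inner ℂ (e m) x = 0 := by
  constructor
  · exact fun h m hm => h _ (basis_mem_firstSpan e hm)
  · intro h
    have : firstSpan e n ≤ (ℂ ∙ x)ᗮ := (firstSpan_le_iff e n _).2 fun m hm => by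
      rw [Submodule.mem_orthogonal_singleton_iff_inner_left]
      exact h m hm
    rw [Submodule.mem_orthogonal]
    exact fun u hu => Submodule.mem_orthogonal_singleton_iff_inner_left.1 (this hu)

theorem basis_mem_orthogonal_firstSpan (e : HilbertBasis ℕ ℂ H) {n m : ℕ} (h : n ≤ m) :
    e m ∈ (firstSpan e n)ᗮ := by
  rw [mem_orthogonal_firstSpan_iff]
  intro i hi
  rw [inner_hilbertBasis, if_neg (by omega)]

theorem finrank_firstSpan (e : HilbertBasis ℕ ℂ H) (n : ℕ) :
    Module.finrank ℂ (firstSpan e n) = n := by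
  have h : LinearIndependent ℂ fun i : Fin n => e i :=
    (e.orthonormal.comp (fun i : Fin n => (i : ℕ)) Fin.val_injective).linearIndependent
  exact (finrank_span_eq_card h).trans (Fintype.card_fin n)

theorem firstProj_basis (e : HilbertBasis ℕ ℂ H) (n m : ℕ) :
    firstProj e n (e m) = if m < n then e m else 0 := by
  split_ifs with h
  · exact Submodule.starProjection_eq_self_iff.2 (basis_mem_firstSpan e h)
  · exact (Submodule.starProjection_apply_eq_zero_iff _).2
      (basis_mem_orthogonal_firstSpan e (not_lt.1 h))

theorem firstProj_mem (e : HilbertBasis ℕ ℂ H) (n : ℕ) (x : H) :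
    firstProj e n x ∈ firstSpan e n :=
  Submodule.starProjection_apply_mem _ _

theorem firstProj_mul_self (e : HilbertBasis ℕ ℂ H) (n : ℕ) :
    firstProj e n * firstProj e n = firstProj e n :=
  Submodule.isIdempotentElem_starProjection _

theorem sub_firstProj_mem (e : HilbertBasis ℕ ℂ H) (n : ℕ) (x : H) :
    x - firstProj e n x ∈ (firstSpan e n)ᗮ :=
  Submodule.sub_starProjection_mem_orthogonal x

theorem norm_sq_sub_firstProj (e : HilbertBasis ℕ ℂ H) (n : ℕ) (x : H) :
    ‖x - firstProj e n x‖ ^ 2 = ‖x‖ ^ 2 - ‖firstProj e n x‖ ^ 2 := by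
  have h := norm_add_sq_eq_norm_sq_add_norm_sq_of_inner_eq_zero (𝕜 := ℂ) _ _
    (sub_firstProj_mem e n x _ (firstProj_mem e n x))
  rw [add_sub_cancel] at h
  linarith

variable [CompleteSpace H]

theorem adjoint_firstProj (e : HilbertBasis ℕ ℂ H) (n : ℕ) :
    adjoint (firstProj e n) = firstProj e n :=
  isSelfAdjoint_starProjection (firstSpan e n)

theorem shiftOp_pow (e : HilbertBasis ℕ ℂ H) (k r : ℕ) :
    shiftOp e k ^ r = shiftOp e (k * r) := by
  refine ext_hilbertBasis e fun m => ?_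
  induction r with
  | zero => simp [shiftOp_apply_basis]
  | succ r ih =>
    rw [pow_succ', mul_apply_eq_comp, ih, shiftOp_apply_basis, shiftOp_apply_basis,
      shiftOp_apply_basis]
    congr 1
    ring

theorem norm_shiftOp_apply (e : HilbertBasis ℕ ℂ H) (k : ℕ) (x : H) : ‖shiftOp e k x‖ = ‖x‖ :=
  LinearIsometry.norm_map _ x

theorem adjoint_shiftOp_apply_shiftOp (e : HilbertBasis ℕ ℂ H) (k : ℕ) (x : H) :
    adjoint (shiftOp e k) (shiftOp e k x) = x := by
  have := LinearIsometry.adjoint_comp_self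
    ((orthonormal_shifted e k).orthogonalFamily.linearIsometry.comp e.repr.toLinearIsometry)
  exact congrArg (fun A : H →L[ℂ] H => A x) this

theorem adjoint_shiftOp_basis (e : HilbertBasis ℕ ℂ H) (k m : ℕ) :
    adjoint (shiftOp e k) (e m) = if m < k then 0 else e (m - k) := by
  split_ifs with h
  · apply e.repr.injective
    ext i
    rw [e.repr_apply_apply, adjoint_inner_right, shiftOp_apply_basis, inner_hilbertBasis,
      if_neg (by omega)]
    simp
  · rw [← adjoint_shiftOp_apply_shiftOp e k (e (m - k)), shiftOp_apply_basis,
      Nat.sub_add_cancel (not_lt.1 h)]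

theorem shiftOp_mul_one_sub_firstProj (e : HilbertBasis ℕ ℂ H) (n k : ℕ) :
    shiftOp e k * (1 - firstProj e n) = (1 - firstProj e (n + k)) * shiftOp e k := by
  refine ext_hilbertBasis e fun m => ?_
  simp only [mul_apply_eq_comp, sub_apply, one_apply_eq_self, firstProj_basis, shiftOp_apply_basis,
    add_lt_add_iff_right]
  split_ifs <;> simp [shiftOp_apply_basis]

theorem shiftOp_mul_one_sub_firstProj_mul_adjoint (e : HilbertBasis ℕ ℂ H) (n k : ℕ) :
    shiftOp e k * (1 - firstProj e n) * adjoint (shiftOp e k) = 1 - firstProj e (n + k) := by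
  rw [shiftOp_mul_one_sub_firstProj]
  refine ext_hilbertBasis e fun m => ?_
  simp only [mul_apply_eq_comp, sub_apply, one_apply_eq_self, firstProj_basis,
    adjoint_shiftOp_basis]
  by_cases h : m < k
  · simp [h, show m < n + k by omega]
  · simp [h, shiftOp_apply_basis, Nat.sub_add_cancel (not_lt.1 h), firstProj_basis]

/-- `T` maps `e m` to `e (m + k)` for `m ≥ n`, and the first `n` basis vectors into the span of the
first `n + k` ones. -/
structure ShiftsTail (e : HilbertBasis ℕ ℂ H) (n k : ℕ) (T : H →L[ℂ] H) : Prop where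
  tail : ∀ m, n ≤ m → T (e m) = e (m + k)
  head : ∀ m < n, T (e m) ∈ firstSpan e (n + k)

namespace ShiftsTail

variable {e : HilbertBasis ℕ ℂ H} {n k : ℕ} {T : H →L[ℂ] H}

omit [CompleteSpace H] in
theorem pow_basis (h : ShiftsTail e n k T) (r : ℕ) {m : ℕ} (hm : n ≤ m) :
    (T ^ r) (e m) = e (m + k * r) := by
  induction r with
  | zero => simp
  | succ r ih =>
    rw [pow_succ', mul_apply_eq_comp, ih, h.tail _ (by omega), mul_add, mul_one, add_assoc]

theorem pow_mul_one_sub (h : ShiftsTail e n k T) (r : ℕ) :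
    T ^ r * (1 - firstProj e n) = shiftOp e k ^ r * (1 - firstProj e n) := by
  rw [shiftOp_pow]
  refine ext_hilbertBasis e fun m => ?_
  simp only [mul_apply_eq_comp, sub_apply, one_apply_eq_self, firstProj_basis]
  split_ifs with hm
  · simp
  · simp [h.pow_basis r (not_lt.1 hm), shiftOp_apply_basis]

theorem mul_one_sub (h : ShiftsTail e n k T) :
    T * (1 - firstProj e n) = shiftOp e k * (1 - firstProj e n) := by
  simpa using h.pow_mul_one_sub 1

omit [CompleteSpace H] in
theorem map_firstSpan (h : ShiftsTail e n k T) {j : ℕ} (hj : n ≤ j) {x : H}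
    (hx : x ∈ firstSpan e j) : T x ∈ firstSpan e (j + k) := by
  have : firstSpan e j ≤ (firstSpan e (j + k)).comap T.toLinearMap := by
    rw [firstSpan_le_iff]
    intro m hm
    rw [Submodule.mem_comap, coe_coe]
    by_cases hmn : m < n
    · exact firstSpan_mono e (by omega) (h.head m hmn)
    · rw [h.tail m (not_lt.1 hmn)]
      exact basis_mem_firstSpan e (by omega)
  exact this hx

omit [CompleteSpace H] in
theorem pow_map_firstSpan (h : ShiftsTail e n k T) (r : ℕ) {x : H}
    (hx : x ∈ firstSpan e n) : (T ^ r) x ∈ firstSpan e (n + k * r) := by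
  induction r with
  | zero => simpa using hx
  | succ r ih =>
    rw [pow_succ', mul_apply_eq_comp, mul_add, mul_one, ← add_assoc]
    exact h.map_firstSpan (by omega) ih

theorem sub_add_mul_firstProj (h : ShiftsTail e n k T) :
    T - shiftOp e k + shiftOp e k * firstProj e n = T * firstProj e n := by
  have := h.mul_one_sub
  rw [mul_sub, mul_sub, mul_one, mul_one] at this
  rw [sub_add, ← this, sub_sub_cancel]

/-- On the range of `1 - P` the powers of `S_k` may be replaced by those of `T`. The `j`-th term
becomes `T^j (TP)^(r-j) - T^(j-1) (TP)^(r-j+1)`, and the sum telescopes. -/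
theorem Fop_sub_shiftOp (h : ShiftsTail e n k T) {r : ℕ} (hr : 1 ≤ r) :
    Fop e n k (T - shiftOp e k) r = T ^ r * firstProj e n := by
  obtain ⟨s, rfl⟩ := Nat.exists_eq_add_of_le' hr
  set P := firstProj e n with hP
  have key : ∀ i ∈ Finset.range s, shiftOp e k ^ (1 + i) * (1 - P) * (T * P) ^ (s + 1 - (1 + i)) =
      T ^ (i + 1) * (T * P) ^ (s + 1 - (i + 1)) - T ^ i * (T * P) ^ (s + 1 - i) := by
    intro i hi
    have hi : i < s := Finset.mem_range.1 hi
    rw [add_comm 1 i, ← h.pow_mul_one_sub, show s + 1 - i = s + 1 - (i + 1) + 1 by omega,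
      pow_succ' (T * P), pow_succ T]
    simp only [mul_sub, sub_mul, mul_one, mul_assoc, ← hP]
  rw [Fop, h.sub_add_mul_firstProj, Finset.sum_Ico_eq_sum_range, Nat.add_sub_cancel,
    Finset.sum_congr rfl key, Finset.sum_range_sub (fun i => T ^ i * (T * P) ^ (s + 1 - i))]
  simp [pow_succ, mul_assoc, hP]

theorem adjoint_pow_mul_firstProj (r : ℕ) :
    adjoint (T ^ r * firstProj e n) = firstProj e n * adjoint T ^ r := by
  rw [adjoint_mul, adjoint_firstProj, adjoint_pow]

/-- Pythagoras: `T^r` sends `P_n x` and `x - P_n x` to orthogonal vectors and is isometric on the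
second. -/
theorem norm_sq_pow_apply (h : ShiftsTail e n k T) (r : ℕ) (x : H) :
    ‖(T ^ r) x‖ ^ 2 =
      ‖(T ^ r * firstProj e n) x‖ ^ 2 + (‖x‖ ^ 2 - ‖firstProj e n x‖ ^ 2) := by
  have h1 : (T ^ r) (x - firstProj e n x) = shiftOp e (k * r) (x - firstProj e n x) := by
    rw [← shiftOp_pow]
    exact congrArg (fun A : H →L[ℂ] H => A x) (h.pow_mul_one_sub r)
  have h2 : shiftOp e (k * r) (x - firstProj e n x) ∈ (firstSpan e (n + k * r))ᗮ := by
    have := congrArg (fun A : H →L[ℂ] H => A x) (shiftOp_mul_one_sub_firstProj e n (k * r))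
    simp only [mul_apply_eq_comp, sub_apply, one_apply_eq_self] at this
    rw [this]
    exact sub_firstProj_mem e _ _
  have h3 := norm_add_sq_eq_norm_sq_add_norm_sq_of_inner_eq_zero (𝕜 := ℂ) _ _
    (h2 _ (h.pow_map_firstSpan r (firstProj_mem e n x)))
  rw [← h1, ← map_add, add_sub_cancel, h1, norm_shiftOp_apply] at h3
  rw [← norm_sq_sub_firstProj, mul_apply_eq_comp]
  linarith

/-- Here the splitting by `P_n` is made after applying `(T*)^r`. The part off `P_n` is `(1 -
P_n)(S_k*)^r x`, of the same norm as `x - P_{n+kr} x`. -/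
theorem norm_sq_adjoint_pow_apply (h : ShiftsTail e n k T) (r : ℕ) (x : H) :
    ‖(adjoint T ^ r) x‖ ^ 2 = ‖(adjoint (T ^ r * firstProj e n)) x‖ ^ 2 +
      (‖x‖ ^ 2 - ‖firstProj e (n + k * r) x‖ ^ 2) := by
  have hself : adjoint (1 - firstProj e n) = 1 - firstProj e n := by
    rw [map_sub, adjoint_firstProj, one_def, adjoint_id]
  have h1 : (1 - firstProj e n) * adjoint T ^ r =
      (1 - firstProj e n) * adjoint (shiftOp e (k * r)) := by
    have := congrArg adjoint (h.pow_mul_one_sub r)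
    rwa [adjoint_mul, adjoint_mul, hself, adjoint_pow, shiftOp_pow] at this
  have h2 := norm_sq_sub_firstProj e n ((adjoint T ^ r) x)
  have h3 : (adjoint T ^ r) x - firstProj e n ((adjoint T ^ r) x) =
      ((1 - firstProj e n) * adjoint (shiftOp e (k * r))) x := by
    rw [← h1]
    rfl
  have h4 : ‖((1 - firstProj e n) * adjoint (shiftOp e (k * r))) x‖ ^ 2 =
      ‖x - firstProj e (n + k * r) x‖ ^ 2 := by
    have hidem : ∀ m, (1 - firstProj e m) * (1 - firstProj e m) = 1 - firstProj e m := fun m =>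
      (Submodule.isIdempotentElem_starProjection (firstSpan e m)).one_sub
    have hselfm : adjoint (1 - firstProj e (n + k * r)) = 1 - firstProj e (n + k * r) := by
      rw [map_sub, adjoint_firstProj, one_def, adjoint_id]
    rw [show x - firstProj e (n + k * r) x = (1 - firstProj e (n + k * r)) x from rfl,
      apply_norm_sq_eq_inner_adjoint_left, apply_norm_sq_eq_inner_adjoint_left, adjoint_mul,
      hself, hselfm, adjoint_adjoint, ← mul_def, ← mul_def, hidem, mul_assoc,
      ← mul_assoc (1 - firstProj e n), hidem, ← mul_assoc,
      shiftOp_mul_one_sub_firstProj_mul_adjoint]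
  rw [h3, h4, norm_sq_sub_firstProj] at h2
  rw [adjoint_pow_mul_firstProj, mul_apply_eq_comp]
  linarith

/-- The quadratic forms agree by the norm identity for `r = 1`; complex polarization does the rest.
-/
theorem firstProj_sub_eq (h : ShiftsTail e n k T) :
    firstProj e n - adjoint (T * firstProj e n) * (T * firstProj e n) = 1 - adjoint T * T := by
  apply ContinuousLinearMap.coe_injective
  rw [← ext_inner_map]
  intro x
  have h0 := h.norm_sq_pow_apply 1 x
  rw [pow_one] at h0
  have hP : inner ℂ (firstProj e n x) x = inner ℂ (firstProj e n x) (firstProj e n x) := by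
    nth_rw 1 [← firstProj_mul_self, mul_apply_eq_comp]
    nth_rw 1 [← adjoint_firstProj]
    rw [adjoint_inner_left]
  simp only [coe_coe, sub_apply, one_apply_eq_self, mul_apply_eq_comp, inner_sub_left,
    adjoint_inner_left, hP] at h0 ⊢
  simp only [inner_self_eq_norm_sq_to_K]
  norm_cast
  linarith

end ShiftsTail

theorem shiftsTail_of_perturbation {e : HilbertBasis ℕ ℂ H} {n k : ℕ} {F : H →L[ℂ] H}
    (hr : Fop e n k F 1 * (1 - firstProj e n) = 0)
    (hl : (1 - firstProj e (n + k)) * Fop e n k F 1 = 0) :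
    ShiftsTail e n k (shiftOp e k + F) := by
  rw [Fop_one] at hr hl
  constructor
  · intro m hm
    have := congrArg (fun A : H →L[ℂ] H => A (e m)) hr
    simp only [mul_apply_eq_comp, sub_apply, one_apply_eq_self, firstProj_basis,
      if_neg (not_lt.2 hm), sub_zero, add_apply, map_zero, add_zero, zero_apply] at this
    rw [add_apply, this, add_zero, shiftOp_apply_basis]
  · intro m hm
    have := congrArg (fun A : H →L[ℂ] H => A (e m)) hl
    simp only [mul_apply_eq_comp, sub_apply, one_apply_eq_self, firstProj_basis, if_pos hm,
      add_apply, zero_apply] at this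
    rw [add_apply, add_comm (shiftOp e k (e m)), sub_eq_zero.1 this]
    exact firstProj_mem e _ _

end ShiftedTail

/-! ### A Wold-type basis adapted to the defect spaces. -/

section WanderingBasis

open ContinuousLinearMap

variable {H : Type*} [NormedAddCommGroup H] [InnerProductSpace ℂ H]

theorem exists_seq_extending_by_map (n : ℕ) {k : ℕ} (hk : 1 ≤ k) (b c : ℕ → H) (T : H →L[ℂ] H) :
    ∃ v : ℕ → H, (∀ m < n, v m = b m) ∧ (∀ i < k, v (n + i) = c i) ∧
      ∀ m, n ≤ m → v (m + k) = T (v m) := by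
  -- With `m - n = qk + i` and `i < k`, the vector at `m ≥ n` is `T^q c_i`.
  refine ⟨fun m => if m < n then b m else (T ^ ((m - n) / k)) (c ((m - n) % k)),
    fun m hm => if_pos hm, fun i hi => ?_, fun m hm => ?_⟩
  · simp [Nat.div_eq_of_lt hi, Nat.mod_eq_of_lt hi]
  · simp only [if_neg (not_lt.2 hm), if_neg (show ¬ m + k < n by omega)]
    rw [show m + k - n = m - n + k by omega, Nat.add_div_right _ (by omega), Nat.add_mod_right,
      pow_succ', mul_apply_eq_comp]

theorem exists_orthonormal_seq (D : Submodule ℂ H) [FiniteDimensional ℂ D] {n : ℕ}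
    (hn : Module.finrank ℂ D = n) :
    ∃ b : ℕ → H, (∀ i < n, b i ∈ D) ∧
      ∀ i < n, ∀ j < n, inner ℂ (b i) (b j) = if i = j then (1 : ℂ) else 0 := by
  subst hn
  let u := stdOrthonormalBasis ℂ D
  refine ⟨fun i => if h : i < Module.finrank ℂ D then (u ⟨i, h⟩ : H) else 0,
    fun i hi => by simp [hi], fun i hi j hj => ?_⟩
  have := orthonormal_iff_ite.1 u.orthonormal ⟨i, hi⟩ ⟨j, hj⟩
  simpa [hi, hj] using this

theorem eq_firstSpan_of_finrank_eq (e : HilbertBasis ℕ ℂ H) {D : Submodule ℂ H}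
    [FiniteDimensional ℂ D] {n : ℕ} (hn : Module.finrank ℂ D = n) (h : ∀ m < n, e m ∈ D) :
    firstSpan e n = D :=
  Submodule.eq_of_le_of_finrank_eq ((firstSpan_le_iff e n D).2 h) ((finrank_firstSpan e n).trans
    hn.symm)

theorem le_span_range_of_orthonormal {v : ℕ → H} (hv : Orthonormal ℂ v) {D : Submodule ℂ H}
    [FiniteDimensional ℂ D] {n : ℕ} (hn : Module.finrank ℂ D = n) (h : ∀ m < n, v m ∈ D) :
    D ≤ Submodule.span ℂ (Set.range v) := by
  have hli : LinearIndependent ℂ fun i : Fin n => v i :=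
    (hv.comp (fun i : Fin n => (i : ℕ)) Fin.val_injective).linearIndependent
  have h1 : Submodule.span ℂ (Set.range fun i : Fin n => v i) ≤ D := by
    rw [Submodule.span_le]
    rintro _ ⟨i, rfl⟩
    exact h i i.2
  have h2 := Submodule.eq_of_le_of_finrank_eq h1
    ((finrank_span_eq_card hli).trans ((Fintype.card_fin n).trans hn.symm))
  rw [← h2]
  refine Submodule.span_mono ?_
  rintro _ ⟨i, rfl⟩
  exact ⟨i, rfl⟩

variable [CompleteSpace H]

theorem exists_shiftsTail_basis {T : H →L[ℂ] H} (hT : IsCNUContraction T)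
    (hle : defectSpace T ≤ defectSpace (adjoint T))
    [FiniteDimensional ℂ (defectSpace (adjoint T))] {n k : ℕ} (hk : 1 ≤ k)
    (hn : Module.finrank ℂ (defectSpace T) = n)
    (hnk : Module.finrank ℂ
      (defectSpace (adjoint T) ⊓ (defectSpace T)ᗮ : Submodule ℂ H) = k) :
    ∃ e : HilbertBasis ℕ ℂ H, firstSpan e n = defectSpace T ∧
      firstSpan e (n + k) = defectSpace (adjoint T) ∧ ShiftsTail e n k T := by
  obtain ⟨hT1, hbot⟩ := isCNUContraction_iff.1 hT
  set D := defectSpace T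
  set D' := defectSpace (adjoint T) with hD'
  have : FiniteDimensional ℂ D := Submodule.finiteDimensional_of_le hle
  have : FiniteDimensional ℂ (D' ⊓ Dᗮ : Submodule ℂ H) :=
    Submodule.finiteDimensional_of_le inf_le_left
  have hn' : Module.finrank ℂ D' = n + k := by
    rw [← hn, ← hnk, inf_comm]
    exact (Submodule.finrank_add_inf_finrank_orthogonal hle).symm
  obtain ⟨b, hb, hbo⟩ := exists_orthonormal_seq D hn
  obtain ⟨c, hc, hco⟩ := exists_orthonormal_seq (D' ⊓ Dᗮ) hnk
  obtain ⟨v, hvb, hvc, hvT⟩ := exists_seq_extending_by_map n hk b c T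
  have hD'D : D'ᗮ ≤ Dᗮ := Submodule.orthogonal_le hle
  have hv1 : ∀ m < n, v m ∈ D := fun m hm => hvb m hm ▸ hb m hm
  have hv2 : ∀ m, n ≤ m → m < n + k → v m ∈ D' ⊓ Dᗮ := by
    intro m h1 h2
    obtain ⟨i, rfl⟩ := Nat.exists_eq_add_of_le h1
    rw [hvc i (by omega)]
    exact hc i (by omega)
  have hv3 : ∀ m, n ≤ m → v m ∈ Dᗮ := by
    intro m
    induction m using Nat.strong_induction_on with
    | _ m ih =>
      intro hm
      by_cases h : m < n + k
      · exact (hv2 m hm h).2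
      · obtain ⟨i, rfl⟩ := Nat.exists_eq_add_of_le' (show k ≤ m by omega)
        rw [hvT i (by omega)]
        exact hD'D (map_orthogonal_defectSpace hT1 (ih i (by omega) (by omega)))
  have hv4 : ∀ m, n ≤ m → v (m + k) ∈ D'ᗮ := fun m hm => by
    rw [hvT m hm]
    exact map_orthogonal_defectSpace hT1 (hv3 m hm)
  have hv5 : ∀ m < n + k, v m ∈ D' := fun m hm => by
    by_cases h : m < n
    · exact hle (hv1 m h)
    · exact (hv2 m (by omega) hm).1
  -- Induction: when both indices are at least `n + k`, lower both by `k`, since `T` preserves inner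
  -- products on `Dᗮ`. In the remaining cases the vectors lie in orthogonal subspaces or in one of
  -- the two chosen finite bases.
  have hle_inner : ∀ m m', m ≤ m' → inner ℂ (v m) (v m') = if m = m' then (1 : ℂ) else 0 := by
    intro m
    induction m using Nat.strong_induction_on with
    | _ m ih =>
      intro m' hmm'
      by_cases h1 : m' < n
      · rw [hvb m (by omega), hvb m' h1]
        exact hbo m (by omega) m' h1
      by_cases h2 : m < n
      · rw [if_neg (by omega)]
        exact hv3 m' (by omega) _ (hv1 m h2)
      by_cases h3 : m' < n + k
      · obtain ⟨i, rfl⟩ := Nat.exists_eq_add_of_le (not_lt.1 h2)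
        obtain ⟨j, rfl⟩ := Nat.exists_eq_add_of_le (not_lt.1 h1)
        rw [hvc i (by omega), hvc j (by omega), hco i (by omega) j (by omega)]
        simp
      obtain ⟨j, rfl⟩ := Nat.exists_eq_add_of_le' (show k ≤ m' by omega)
      by_cases h4 : m < n + k
      · rw [if_neg (by omega)]
        exact hv4 j (by omega) _ (hv5 m h4)
      · obtain ⟨i, rfl⟩ := Nat.exists_eq_add_of_le' (show k ≤ m by omega)
        rw [hvT i (by omega), hvT j (by omega),
          inner_map_map_of_mem_orthogonal_defectSpace hT1 _ (hv3 j (by omega)),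
          ih i (by omega) j (by omega)]
        simp
  have hv : Orthonormal ℂ v := by
    rw [orthonormal_iff_ite]
    intro i j
    rcases le_total i j with h | h
    · exact hle_inner i j h
    · rw [← inner_conj_symm, hle_inner j i h]
      simp only [eq_comm (a := j)]
      split_ifs <;> simp
  have hspan : (Submodule.span ℂ (Set.range v))ᗮ = ⊥ := by
    set M := (Submodule.span ℂ (Set.range v))ᗮ with hM
    -- The first `n + k` vectors already span `D'`, so both `T` and `T*` are isometric on `M`. It
    -- remains to see that `M` is invariant under both, for then it lies in the unitary part.
    have hMD' : M ≤ D'ᗮ := Submodule.orthogonal_le (le_span_range_of_orthonormal hv hn' hv5)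
    have hmem : ∀ x, x ∈ M ↔ ∀ m, inner ℂ (v m) x = 0 := by
      intro x
      refine ⟨fun h m => h _ (Submodule.subset_span ⟨m, rfl⟩), fun h => ?_⟩
      rw [hM, Submodule.mem_orthogonal']
      intro u hu
      refine Submodule.mem_orthogonal_singleton_iff_inner_right.1
        ((Submodule.span_le.2 ?_ : _ ≤ (ℂ ∙ x)ᗮ) hu)
      rintro _ ⟨m, rfl⟩
      exact Submodule.mem_orthogonal_singleton_iff_inner_left.2 (h m)
    rw [eq_bot_iff, ← hbot]
    refine le_unitaryPart hT1 (fun x hx => ⟨?_, ?_⟩) (fun x hx => ⟨?_, ?_⟩)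
    · rw [hmem] at ⊢
      intro m
      have hx' := hD'D (hMD' hx)
      by_cases h : m < n + k
      · exact map_orthogonal_defectSpace hT1 hx' _ (hv5 m h)
      · obtain ⟨i, rfl⟩ := Nat.exists_eq_add_of_le' (show k ≤ m by omega)
        rw [hvT i (by omega), inner_map_map_of_mem_orthogonal_defectSpace hT1 _ hx']
        exact (hmem x).1 hx i
    · exact (mem_orthogonal_defectSpace_iff_norm_eq hT1 x).1 (hD'D (hMD' hx))
    · rw [hmem]
      intro m
      by_cases h : m < n
      · exact adjoint_map_orthogonal_defectSpace hT1 (hMD' hx) _ (hv1 m h)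
      · rw [adjoint_inner_right, ← hvT m (not_lt.1 h)]
        exact (hmem x).1 hx _
    · exact (mem_orthogonal_defectSpace_iff_norm_eq (norm_adjoint_le_one hT1) x).1 (hMD' hx)
  have he : ⇑(HilbertBasis.mkOfOrthogonalEqBot hv hspan) = v :=
    HilbertBasis.coe_mkOfOrthogonalEqBot hv hspan
  have hs1 := eq_firstSpan_of_finrank_eq (HilbertBasis.mkOfOrthogonalEqBot hv hspan) hn
    (by rwa [he])
  have hs2 := eq_firstSpan_of_finrank_eq (HilbertBasis.mkOfOrthogonalEqBot hv hspan) hn'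
    (by rwa [he])
  refine ⟨_, hs1, hs2, ?_, ?_⟩
  · rw [he]
    exact fun m hm => (hvT m hm).symm
  · intro m hm
    rw [hs2, he]
    exact map_defectSpace hT1 (hv1 m hm)

end WanderingBasis

/-! ### Translation between the perturbation conditions and the defect spaces. -/

section Characterization

open ContinuousLinearMap

variable {H : Type*} [NormedAddCommGroup H] [InnerProductSpace ℂ H] [CompleteSpace H]

theorem range_one_sub_eq_defectSpace {T : H →L[ℂ] H} (hT : ‖T‖ ≤ 1)
    [FiniteDimensional ℂ (LinearMap.range (1 - adjoint T * T).toLinearMap)] :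
    LinearMap.range (1 - adjoint T * T).toLinearMap = defectSpace T := by
  rw [defectSpace_eq_closure_range hT]
  exact (Submodule.closed_of_finiteDimensional _).submodule_topologicalClosure_eq.symm

namespace ShiftsTail

variable {e : HilbertBasis ℕ ℂ H} {n k : ℕ} {T : H →L[ℂ] H}

theorem norm_le_firstProj_iff (h : ShiftsTail e n k T) (r : ℕ) (x : H) :
    ‖(T ^ r * firstProj e n) x‖ ≤ ‖firstProj e n x‖ ↔ ‖(T ^ r) x‖ ≤ ‖x‖ := by
  have := h.norm_sq_pow_apply r x
  rw [← sq_le_sq₀ (norm_nonneg _) (norm_nonneg _),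
    ← sq_le_sq₀ (norm_nonneg ((T ^ r) x)) (norm_nonneg _)]
  constructor <;> intro <;> linarith

theorem norm_adjoint_le_firstProj_iff (h : ShiftsTail e n k T) (r : ℕ) (x : H) :
    ‖adjoint (T ^ r * firstProj e n) x‖ ≤ ‖firstProj e (n + k * r) x‖ ↔
      ‖(adjoint T ^ r) x‖ ≤ ‖x‖ := by
  have := h.norm_sq_adjoint_pow_apply r x
  rw [← sq_le_sq₀ (norm_nonneg _) (norm_nonneg _),
    ← sq_le_sq₀ (norm_nonneg ((adjoint T ^ r) x)) (norm_nonneg _)]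
  constructor <;> intro <;> linarith

theorem norm_eq_firstProj_iff (h : ShiftsTail e n k T) (r : ℕ) (x : H) :
    ‖(T ^ r * firstProj e n) x‖ = ‖firstProj e n x‖ ↔ ‖(T ^ r) x‖ = ‖x‖ := by
  have := h.norm_sq_pow_apply r x
  rw [← sq_eq_sq₀ (norm_nonneg _) (norm_nonneg _),
    ← sq_eq_sq₀ (norm_nonneg ((T ^ r) x)) (norm_nonneg _)]
  constructor <;> intro <;> linarith

theorem norm_adjoint_eq_firstProj_iff (h : ShiftsTail e n k T) (r : ℕ) (x : H) :
    ‖adjoint (T ^ r * firstProj e n) x‖ = ‖firstProj e (n + k * r) x‖ ↔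
      ‖(adjoint T ^ r) x‖ = ‖x‖ := by
  have := h.norm_sq_adjoint_pow_apply r x
  rw [← sq_eq_sq₀ (norm_nonneg _) (norm_nonneg _),
    ← sq_eq_sq₀ (norm_nonneg ((adjoint T ^ r) x)) (norm_nonneg _)]
  constructor <;> intro <;> linarith

theorem finiteDimensional_range_sub_shiftOp (h : ShiftsTail e n k T) :
    FiniteDimensional ℂ (LinearMap.range (T - shiftOp e k).toLinearMap) := by
  have h1 : T - shiftOp e k = (T - shiftOp e k) * firstProj e n := by
    have := h.sub_add_mul_firstProj
    rw [sub_mul, ← this, add_sub_cancel_right]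
  have h2 : LinearMap.range (T - shiftOp e k).toLinearMap ≤
      (firstSpan e n).map (T - shiftOp e k).toLinearMap := by
    rintro _ ⟨x, rfl⟩
    exact ⟨firstProj e n x, firstProj_mem e n x,
      (congrArg (fun A : H →L[ℂ] H => A x) h1).symm⟩
  exact Submodule.finiteDimensional_of_le h2

theorem range_one_sub_le_firstSpan (h : ShiftsTail e n k T) :
    LinearMap.range (1 - adjoint T * T).toLinearMap ≤ firstSpan e n := by
  rintro _ ⟨x, rfl⟩
  rw [← h.firstProj_sub_eq, ← pow_one T, adjoint_pow_mul_firstProj]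
  exact Submodule.sub_mem _ (firstProj_mem e n x) (firstProj_mem e n _)

theorem defectSpace_le_firstSpan (h : ShiftsTail e n k T) (hT : ‖T‖ ≤ 1) :
    defectSpace T ≤ firstSpan e n := by
  have := Submodule.finiteDimensional_of_le h.range_one_sub_le_firstSpan
  rw [← range_one_sub_eq_defectSpace hT]
  exact h.range_one_sub_le_firstSpan

/-- Compare orthogonal complements. If `TT*x = x`, then `T*x` is orthogonal to the first `n`
vectors, so `x = S_k T*x` lies in the tail from `n + k`. On that tail the norm identity gives `‖T*x‖
≥ ‖x‖`. -/
theorem defectSpace_adjoint_eq (h : ShiftsTail e n k T) (hT : ‖T‖ ≤ 1)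
    (hD : defectSpace T = firstSpan e n) : defectSpace (adjoint T) = firstSpan e (n + k) := by
  rw [← orthogonal_orthogonal_defectSpace, ← (firstSpan e (n + k)).orthogonal_orthogonal]
  congr 1
  have hT' := norm_adjoint_le_one hT
  ext x
  constructor
  · intro hx
    have hy := adjoint_map_orthogonal_defectSpace hT hx
    rw [mem_orthogonal_defectSpace_iff hT', adjoint_adjoint] at hx
    rw [hD] at hy
    have h0 : firstProj e n (adjoint T x) = 0 :=
      (Submodule.starProjection_apply_eq_zero_iff _).2 hy
    have h1 : T (adjoint T x) = (T * (1 - firstProj e n)) (adjoint T x) := by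
      simp [h0]
    rw [h.mul_one_sub, shiftOp_mul_one_sub_firstProj, hx] at h1
    rw [h1]
    exact sub_firstProj_mem e _ _
  · intro hx
    rw [mem_orthogonal_defectSpace_iff_norm_eq hT']
    refine le_antisymm (norm_apply_le_of_norm_le_one hT' x) ?_
    have h0 : firstProj e (n + k) x = 0 := (Submodule.starProjection_apply_eq_zero_iff _).2 hx
    have h1 := h.norm_sq_adjoint_pow_apply 1 x
    rw [mul_one, h0, norm_zero, pow_one] at h1
    rw [← sq_le_sq₀ (norm_nonneg _) (norm_nonneg _)]
    nlinarith [sq_nonneg ‖adjoint (T ^ 1 * firstProj e n) x‖]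

omit [CompleteSpace H] in
theorem finrank_firstSpan_inf_orthogonal (e : HilbertBasis ℕ ℂ H) (n k : ℕ) :
    Module.finrank ℂ (firstSpan e (n + k) ⊓ (firstSpan e n)ᗮ : Submodule ℂ H) = k := by
  have := Submodule.finrank_add_inf_finrank_orthogonal (firstSpan_mono e (Nat.le_add_right n k))
  rw [finrank_firstSpan, finrank_firstSpan, inf_comm] at this
  omega

theorem perturbationConditions (h : ShiftsTail e n k T) (hT : IsCNUContraction T)
    (hD : firstSpan e n = defectSpace T) (hD' : firstSpan e (n + k) = defectSpace (adjoint T)) :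
    PerturbationConditions e n k (T - shiftOp e k) := by
  obtain ⟨hT1, hbot⟩ := isCNUContraction_iff.1 hT
  have hF : ∀ r, 1 ≤ r → Fop e n k (T - shiftOp e k) r = T ^ r * firstProj e n :=
    fun r hr => h.Fop_sub_shiftOp hr
  have hF1 : Fop e n k (T - shiftOp e k) 1 = T * firstProj e n := by
    rw [hF 1 le_rfl, pow_one]
  have hpow : ∀ r (x : H), ‖(T ^ r) x‖ ≤ ‖x‖ := fun r x =>
    norm_apply_le_of_norm_le_one (norm_pow_le_one hT1 r) x
  have hpow' : ∀ r (x : H), ‖(adjoint T ^ r) x‖ ≤ ‖x‖ := fun r x =>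
    norm_apply_le_of_norm_le_one (norm_pow_le_one (norm_adjoint_le_one hT1) r) x
  refine ⟨?_, ?_, ?_, ?_, fun r hr x => ?_, fun r hr x => ?_, fun x hx => ?_⟩
  · rw [hF1, h.firstProj_sub_eq]
    have := Submodule.finiteDimensional_of_le h.range_one_sub_le_firstSpan
    rw [LinearMap.rank, range_one_sub_eq_defectSpace hT1, ← hD, ← Module.finrank_eq_rank,
      finrank_firstSpan]
  · rw [hF1, mul_assoc, mul_sub, mul_one, firstProj_mul_self, sub_self, mul_zero]
  · rw [hF1]
    ext x
    rw [← mul_assoc, mul_apply_eq_comp, mul_apply_eq_comp, sub_apply, one_apply_eq_self,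
      sub_eq_zero.2]
    · rfl
    · refine (Submodule.starProjection_eq_self_iff.2 ?_).symm
      exact h.map_firstSpan le_rfl (firstProj_mem e n x)
  · have : FiniteDimensional ℂ (defectSpace (adjoint T)) := by
      rw [← hD']
      infer_instance
    obtain ⟨c, hc, hcx⟩ := exists_norm_sq_defect_le hT1
      (by rw [← hD, ← hD']; exact firstSpan_mono e (Nat.le_add_right n k))
    refine ⟨c, hc, fun x => ?_⟩
    -- Substituting both norm identities cancels `‖x‖²` and turns the defect inequality into
    -- condition 3.
    have h1 := h.norm_sq_pow_apply 1 x
    have h2 := h.norm_sq_adjoint_pow_apply 1 x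
    have h3 := hcx x
    rw [hF 1 le_rfl]
    rw [pow_one] at h1
    rw [mul_one, pow_one] at h2
    rw [h1, h2] at h3
    rw [pow_one] at *
    linarith
  · rw [hF r hr, h.norm_le_firstProj_iff]
    exact hpow r x
  · rw [hF r hr, h.norm_adjoint_le_firstProj_iff]
    exact hpow' r x
  · rw [← Submodule.mem_bot ℂ, ← hbot, mem_unitaryPart_iff hT1]
    intro r
    cases r with
    -- The unitary part includes the exponent `0`, which is trivial; the conditions start at `r =
    -- 1`.
    | zero => simp
    | succ r =>
      have := hx (r + 1) (by omega)
      rwa [hF _ (by omega), h.norm_eq_firstProj_iff, h.norm_adjoint_eq_firstProj_iff] at this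

theorem isCNUContraction (h : ShiftsTail e n k T)
    (hF : PerturbationConditions e n k (T - shiftOp e k)) : IsCNUContraction T := by
  have hT1 : ‖T‖ ≤ 1 := by
    refine T.opNorm_le_bound zero_le_one fun x => ?_
    have := hF.norm_le 1 le_rfl x
    rwa [h.Fop_sub_shiftOp le_rfl, h.norm_le_firstProj_iff, pow_one, ← one_mul ‖x‖] at this
  refine isCNUContraction_iff.2 ⟨hT1, ?_⟩
  rw [eq_bot_iff]
  intro x hx
  refine hF.eq_zero_of_norm_eq x fun r hr => ?_
  rw [h.Fop_sub_shiftOp hr, h.norm_eq_firstProj_iff, h.norm_adjoint_eq_firstProj_iff]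
  exact (mem_unitaryPart_iff hT1 x).1 hx r

/-- The defect space lies in the span because `1 - T*T = P_n - F_1*F_1`; the rank condition forces
equality of dimensions. -/
theorem defectSpace_eq_firstSpan (h : ShiftsTail e n k T) (hT : ‖T‖ ≤ 1)
    (hF : PerturbationConditions e n k (T - shiftOp e k)) : defectSpace T = firstSpan e n := by
  have hfin := Submodule.finiteDimensional_of_le h.range_one_sub_le_firstSpan
  have hrank := hF.rank_eq
  rw [h.Fop_sub_shiftOp le_rfl, pow_one, h.firstProj_sub_eq, LinearMap.rank,
    range_one_sub_eq_defectSpace hT] at hrank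
  exact Submodule.eq_of_le_of_finrank_eq (h.defectSpace_le_firstSpan hT)
    ((Module.finrank_eq_of_rank_eq hrank).trans (finrank_firstSpan e n).symm)

end ShiftsTail

end Characterization

theorem theorem3p2 {H : Type*} [NormedAddCommGroup H] [InnerProductSpace ℂ H] [CompleteSpace H]
    (n k : ℕ) (hn : 1 ≤ n) (hk : 1 ≤ k) (T : H →L[ℂ] H) :
    (IsCNUContraction T ∧
      defectSpace T ≤ defectSpace (ContinuousLinearMap.adjoint T) ∧
      Module.rank ℂ (defectSpace T) = n ∧
      FiniteDimensional ℂ (defectSpace (ContinuousLinearMap.adjoint T)) ∧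
      Module.rank ℂ
        (defectSpace (ContinuousLinearMap.adjoint T) ⊓ (defectSpace T)ᗮ : Submodule ℂ H) = k) ↔
    ∃ (e : HilbertBasis ℕ ℂ H) (F : H →L[ℂ] H),
      T = shiftOp e k + F ∧
      FiniteDimensional ℂ (LinearMap.range F.toLinearMap) ∧
      PerturbationConditions e n k F := by
  constructor
  · rintro ⟨hT, hle, hrank, hfin, hrank'⟩
    obtain ⟨e, hD, hD', h⟩ := exists_shiftsTail_basis hT hle hk
      (Module.finrank_eq_of_rank_eq hrank) (Module.finrank_eq_of_rank_eq hrank')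
    exact ⟨e, T - shiftOp e k, (add_sub_cancel _ _).symm,
      h.finiteDimensional_range_sub_shiftOp, h.perturbationConditions hT hD hD'⟩
  · rintro ⟨e, F, hTF, -, hF⟩
    have h : ShiftsTail e n k T := hTF ▸ shiftsTail_of_perturbation hF.supp_right hF.supp_left
    rw [show F = T - shiftOp e k by rw [hTF, add_sub_cancel_left]] at hF
    have hT := h.isCNUContraction hF
    have hD := h.defectSpace_eq_firstSpan hT.1 hF
    have hD' := h.defectSpace_adjoint_eq hT.1 hD
    rw [hD, hD']
    have : FiniteDimensional ℂ (firstSpan e (n + k) ⊓ (firstSpan e n)ᗮ : Submodule ℂ H) :=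
      Submodule.finiteDimensional_of_le inf_le_left
    refine ⟨hT, firstSpan_mono e (Nat.le_add_right n k), ?_, inferInstance, ?_⟩
    · rw [← Module.finrank_eq_rank, finrank_firstSpan]
    · rw [← Module.finrank_eq_rank, ShiftsTail.finrank_firstSpan_inf_orthogonal]
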